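/- **Lemma (Total order, eventually synchronous BullShark).** Let $n=3f+1$ and let $\Pi$ be a set of $n$ parties, at most $f$ of which are Byzantine (arbitrary behaviour); the others are honest and follow the protocol below. Parties communicate through a reliable broadcast with events $r\_bcast_k(m,r)$ and $r\_deliver_i(m,r,p_k)$ satisfying *Agreement* (if an honest $p_i$ outputs $r\_deliver_i(m,r,p_k)$, every honest $p_j$ eventually outputs $r\_deliver_j(m,r,p_k)$), *Integrity* (for each $(r,p_k)$ an honest party outputs $r\_deliver_i(m,r,p_k)$ for at most one $m$ and at most once) and *Validity* (if an honest $p_k$ calls $r\_bcast_k(m,r)$, every honest $p_i$ eventually outputs $r\_deliver_i(m,r,p_k)$). Then in every execution, with arbitrary message delays and timer expirations (in particular in every eventually synchronous one), Total order holds: if an honest $p_i$ outputs $a\_deliver_i(m,r,p_k)$ before $a\_deliver_i(m',r',p_{k'})$, then no honest $p_j$ outputs $a\_deliver_j(m',r',p_{k'})$ before $a\_deliver_j(m,r,p_k)$. *The protocol.* A vertex $v$ has a round, a source, a block, a set of strong edges (vertices of round $v.round-1$) and a set of weak edges (vertices of rounds $<v.round-1$). Each party keeps a local DAG, initially $2f+1$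 hardcoded genesis vertices of round $0$; $DAG[r]$ denotes its vertices of round $r$. A path (strong path) from $v$ to $u$ is a possibly trivial chain of edges (strong edges) whose vertices after $v$ lie in rounds $\ge 1$ of the DAG. Wave $w$ consists of rounds $4w-3,\dots,4w$; it has two predefined leaders, known to all, whose vertices in rounds $4w-3$ and $4w-1$ are its first and second leader vertices. Rounds start at $1$. * *Creating vertices.* Calls $a\_bcast(b,\cdot)$ enqueue the block $b$. On entering a round $r$ (round $1$ at the start), a party sets $wait=true$, waits for a block, creates a vertex of round $r$ with that block, with strong edges to all of $DAG[r-1]$ and with weak edges to the vertices of rounds $r-2,\dots,1$ (in this order) not yet reachable from it, adds the vertex to its DAG, and calls $r\_bcast$ on it with round $r$. * *Deliveries.* On $r\_deliver(v,r,p)$, a vertex $v$ with $v.source=p$, $v.round=r$ and at least $2f+1$ strong edges is added to the DAG if all its edges lead into the DAG, and then the buffered vertices of rounds $\le r$ are retried, in any order; otherwise $v$ is buffered. Other deliveries are ignored. If adding a vertex of a round $r'$ larger than the current round makes $|DAG[r']|\ge 2f+1$, the party enters round $r'$ at once. * *Advancing.* "Trying to advance" from round $r$ means entering round $r+1$ if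 $|DAG[r]|\ge 2f+1$. A party tries this when its timer expires (then also $wait=false$), and after a delivery in its current round $r$ provided that $wait=false$, or $r$ is the first (third) round of a wave and $DAG[r]$ contains a vertex of the wave's first (second) leader, or $r$ is the second (fourth) round and $2f+1$ vertices of $DAG[r]$ have strong paths to the first (second) leader vertex and have sources in the wave's fixed table of steady-state voters (any fixed table; e.g. all parties). * *Committing.* After adding a vertex $v$ to its DAG, a party considers the first leader vertex of the current wave if $v$ is in the third round of that wave, and the second leader vertex of the previous wave if $v$ is in the first round of a wave; if at least $f+1$ strong edges of $v$ lead to vertices with a strong path to this leader vertex, it commits the leader vertex. To commit $\ell$: push $\ell$ on a stack; for $r=\ell.round-2,\ell.round-4,\dots$ while $r>committedRound$ (initially $0$), if the leader vertex $\ell'$ of round $r$ is in the DAG and there is a strong path from $\ell$ to $\ell'$, push $\ell'$ and set $\ell:=\ell'$; then set $committedRound:=\ell.round$. Finally pop the leaders one by one, and for each output $a\_deliver(u.block,u.round,u.source)$ for all vertices $u$ of rounds $\ge1$ to which it has a path and which the party has not yet delivered, in a deterministic order depending only on the set of these vertices and common to all parties. -/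

import Mathlib

namespace BullShark

noncomputable section

open scoped Classical

/-- A vertex of the DAG: round, source, block, strong edges, weak edges. Edges are vertices; the two
sets of edges are represented by lists and only ever used through `strongEdges`, `weakEdges`. -/
inductive Vertex (n : ℕ) (B : Type*) where
  | mk (round : ℕ) (source : Fin n) (block : B)
      (strong : List (Vertex n B)) (weak : List (Vertex n B)) : Vertex n B

namespace Vertex

variable {n : ℕ} {B : Type*}

def round : Vertex n B → ℕ
  | mk r _ _ _ _ => r

def source : Vertex n B → Fin n
  | mk _ p _ _ _ => p

def block : Vertex n B → B
  | mk _ _ b _ _ => b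

def strongEdges : Vertex n B → Finset (Vertex n B)
  | mk _ _ _ s _ => s.toFinset

def weakEdges : Vertex n B → Finset (Vertex n B)
  | mk _ _ _ _ w => w.toFinset

/-- Strong edges lead to the previous round, weak edges to earlier rounds than that. -/
def WellFormed (v : Vertex n B) : Prop :=
  (∀ u ∈ v.strongEdges, u.round + 1 = v.round) ∧ (∀ u ∈ v.weakEdges, u.round + 1 < v.round)

end Vertex

/-- The data that are hardcoded and known to all parties. -/
structure Params (f n : ℕ) (B : Type*) where
  /-- first and second predefined leader of each wave -/
  firstLeader : ℕ → Fin n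
  secondLeader : ℕ → Fin n
  /-- The table of steady-state voters consulted when rounds are advanced. It is never updated in
  this variant of the protocol, and it may be any fixed table (for instance all parties, always). -/
  steadyVoters : ℕ → Finset (Fin n)
  /-- the genesis vertices -/
  genesis : Finset (Vertex n B)
  genesis_card : genesis.card = 2 * f + 1
  genesis_round : ∀ v ∈ genesis, v.round = 0
  /-- the deterministic order in which the elements of a finite set of vertices are delivered -/
  order : Finset (Vertex n B) → List (Vertex n B)
  order_nodup : ∀ S, (order S).Nodup
  mem_order : ∀ S v, v ∈ order S ↔ v ∈ S

/-- The local state of a party. -/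
structure LocalState (n : ℕ) (B : Type*) where
  /-- whether the party has begun (and so has broadcast its vertex of round 1) -/
  started : Bool
  /-- the last round in which the party broadcast a vertex -/
  round : ℕ
  buffer : Finset (Vertex n B)
  wait : Bool
  /-- the local DAG; its entry for round `r` is `dagRound dag r` -/
  dag : Finset (Vertex n B)
  blocksToPropose : List B
  committedRound : ℕ
  deliveredVertices : Finset (Vertex n B)
  /-- the calls `r_bcast(m, r)` made so far -/
  sent : List (Vertex n B × ℕ)
  /-- the outputs `a_deliver(m, r, p)` made so far, oldest first -/
  output : List (B × ℕ × Fin n)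

variable {f n : ℕ} {B : Type*}

def initialState (P : Params f n B) : LocalState n B where
  started := false
  round := 1
  buffer := ∅
  wait := true
  dag := P.genesis
  blocksToPropose := []
  committedRound := 0
  deliveredVertices := ∅
  sent := []
  output := []

/-! ### Data structures and basic utilities -/

def dagRound (dag : Finset (Vertex n B)) (r : ℕ) : Finset (Vertex n B) :=
  dag.filter fun v => v.round = r

/-- There is a path of strong and weak edges from `v` to `u`, all of whose vertices after `v` lie in
rounds `≥ 1` of the DAG. -/
def Path (dag : Finset (Vertex n B)) (v u : Vertex n B) : Prop :=
  Relation.ReflTransGen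
    (fun a b => b ∈ dag ∧ 1 ≤ b.round ∧ (b ∈ a.strongEdges ∨ b ∈ a.weakEdges)) v u

/-- The same with strong edges only. -/
def StrongPath (dag : Finset (Vertex n B)) (v u : Vertex n B) : Prop :=
  Relation.ReflTransGen (fun a b => b ∈ dag ∧ 1 ≤ b.round ∧ b ∈ a.strongEdges) v u

def getVertex (dag : Finset (Vertex n B)) (p : Fin n) (r : ℕ) : Option (Vertex n B) :=
  if h : ∃ v ∈ dagRound dag r, v.source = p then some h.choose else none

/-- The wave `⌈r / 4⌉` of round `r`. -/
def wave (r : ℕ) : ℕ := (r + 3) / 4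

/-- The vertex of the first leader of wave `w`, in round `4w - 3`. -/
def getFirstLeader (P : Params f n B) (dag : Finset (Vertex n B)) (w : ℕ) : Option (Vertex n B) :=
  if w = 0 then none else getVertex dag (P.firstLeader w) (4 * w - 3)

/-- The vertex of the second leader of wave `w`, in round `4w - 1`. -/
def getSecondLeader (P : Params f n B) (dag : Finset (Vertex n B)) (w : ℕ) : Option (Vertex n B) :=
  if w = 0 then none else getVertex dag (P.secondLeader w) (4 * w - 1)

/-- The weak edges of a new vertex: for `r = round - 2` down to `1`, add all vertices of round `r`
of the DAG that are not yet reachable. (Vertices of one round do not reach each other, so they can be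
treated simultaneously.) -/
def newWeakEdges (i : Fin n) (dag : Finset (Vertex n B)) (round : ℕ) (b : B) :
    Finset (Vertex n B) :=
  ((List.range (round - 2)).map (· + 1)).reverse.foldl
    (fun weak r => weak ∪ (dagRound dag r).filter fun u =>
      ¬ Path dag (Vertex.mk round i b (dagRound dag (round - 1)).toList weak.toList) u)
    ∅

/-- The vertex that party `i` creates in `round` with block `b`. -/
def newVertex (i : Fin n) (dag : Finset (Vertex n B)) (round : ℕ) (b : B) : Vertex n B :=
  Vertex.mk round i b (dagRound dag (round - 1)).toList (newWeakEdges i dag round b).toList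

/-! ### Committing leaders and ordering the DAG -/

/-- Pop one leader `v`: output the vertices of its causal history not yet delivered. -/
def orderLeader (P : Params f n B) (s : LocalState n B) (v : Vertex n B) : LocalState n B :=
  let toDeliver := s.dag.filter fun u => 1 ≤ u.round ∧ Path s.dag v u ∧ u ∉ s.deliveredVertices
  { s with
    output := s.output ++ (P.order toDeliver).map fun u => (u.block, u.round, u.source)
    deliveredVertices := s.deliveredVertices ∪ toDeliver }

/-- Pop and order all leaders of the stack (whose top is the head of the list). -/
def orderVertices (P : Params f n B) (s : LocalState n B) (stack : List (Vertex n B)) :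
    LocalState n B :=
  stack.foldl (orderLeader P) s

/-- The loop of `commit_leader`: while `r` exceeds `committed`, if the leader of round `r` can be
reached from the current leader `v` by a strong path, push it and make it the current leader; then
decrease `r` by two. Returns the final current leader and the final stack. -/
def leaderLoop (P : Params f n B) (dag : Finset (Vertex n B)) (committed : ℕ) (r : ℕ)
    (v : Vertex n B) (stack : List (Vertex n B)) : Vertex n B × List (Vertex n B) :=
  if _h : committed < r then
    match (if r % 4 = 1 then getFirstLeader P dag (wave r) else getSecondLeader P dag (wave r)) with
    | some u =>
      if StrongPath dag v u then leaderLoop P dag committed (r - 2) u (u :: stack)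
      else leaderLoop P dag committed (r - 2) v stack
    | none => leaderLoop P dag committed (r - 2) v stack
  else (v, stack)
termination_by r
decreasing_by all_goals omega

/-- `commit_leader(v)`. The leader stack is empty before and after, so it is kept local. -/
def commitLeader (P : Params f n B) (s : LocalState n B) (v : Vertex n B) : LocalState n B :=
  let res := leaderLoop P s.dag s.committedRound (v.round - 2) v [v]
  orderVertices P { s with committedRound := res.1.round } res.2

/-- `try_commit(votes, v)`: a leader needs at least `f + 1` votes; `none` never gets a vote. -/
def tryCommit (P : Params f n B) (s : LocalState n B) (votes : Finset (Vertex n B)) :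
    Option (Vertex n B) → LocalState n B
  | none => s
  | some v =>
    if f + 1 ≤ (votes.filter fun u => StrongPath s.dag u v).card then commitLeader P s v else s

def tryOrdering (P : Params f n B) (s : LocalState n B) (v : Vertex n B) : LocalState n B :=
  if v.round % 4 = 1 then
    tryCommit P s v.strongEdges (getSecondLeader P s.dag (wave v.round - 1))
  else if v.round % 4 = 3 then
    tryCommit P s v.strongEdges (getFirstLeader P s.dag (wave v.round))
  else s

/-! ### Construction of the DAG

`none` as a result means that the procedure is still waiting for a block to propose. -/

/-- All edges of `v` lead into the local DAG. -/
def Ready (s : LocalState n B) (v : Vertex n B) : Prop :=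
  ∀ u ∈ v.strongEdges ∪ v.weakEdges, u ∈ s.dag

/-- `try_add_to_dag(v)` in the case `v.round ≤ round`, where no jump to a later round happens. -/
def tryAddNoJump (P : Params f n B) (s : LocalState n B) (v : Vertex n B) : LocalState n B :=
  if Ready s v then
    tryOrdering P { s with dag := insert v s.dag, buffer := s.buffer.erase v } v
  else s

/-- `broadcast_vertex(r)`, called only with `r` equal to the current round: take the next block,
create the vertex, add it to the local DAG, and call `r_bcast`. -/
def broadcastVertex (P : Params f n B) (i : Fin n) (s : LocalState n B) (r : ℕ) :
    Option (LocalState n B) :=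
  match s.blocksToPropose with
  | [] => none
  | b :: rest =>
    let v := newVertex i s.dag r b
    let s₁ := tryAddNoJump P { s with blocksToPropose := rest } v
    some { s₁ with sent := s₁.sent ++ [(v, r)] }

/-- `try_add_to_dag(v)`, with its Boolean result. -/
def tryAddToDag (P : Params f n B) (i : Fin n) (s : LocalState n B) (v : Vertex n B) :
    Option (LocalState n B × Bool) :=
  if Ready s v then do
    let s₁ : LocalState n B := { s with dag := insert v s.dag }
    let s₂ ←
      if 2 * f + 1 ≤ (dagRound s₁.dag v.round).card ∧ s₁.round < v.round then
        broadcastVertex P i { s₁ with round := v.round, wait := true } v.round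
      else some s₁
    return (tryOrdering P { s₂ with buffer := s₂.buffer.erase v } v, true)
  else some (s, false)

def tryAdvanceRound (P : Params f n B) (i : Fin n) (s : LocalState n B) :
    Option (LocalState n B) :=
  if 2 * f + 1 ≤ (dagRound s.dag s.round).card then
    broadcastVertex P i { s with round := s.round + 1, wait := true } (s.round + 1)
  else some s

/-- A vertex delivered by the reliable broadcast instance of party `p` and round `r` is legal. -/
def Legal (f : ℕ) (v : Vertex n B) (r : ℕ) (p : Fin n) : Prop :=
  v.source = p ∧ v.round = r ∧ 2 * f + 1 ≤ v.strongEdges.card ∧ v.WellFormed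

/-- `2f + 1` vertices of round `r` from steady-state voters have a strong path to the leader. -/
def EnoughVotes (P : Params f n B) (s : LocalState n B) (r : ℕ) (leader : Option (Vertex n B)) :
    Prop :=
  ∃ U ⊆ dagRound s.dag r, U.card = 2 * f + 1 ∧
    ∀ u ∈ U, u.source ∈ P.steadyVoters (wave r) ∧ ∃ v, leader = some v ∧ StrongPath s.dag u v

/-- The condition, checked after a delivery in the current round `r`, for trying to advance. -/
def AdvanceCondition (P : Params f n B) (s : LocalState n B) (r : ℕ) : Prop :=
  s.wait = false ∨
  (r % 4 = 1 ∧ ∃ v ∈ dagRound s.dag r, v.source = P.firstLeader (wave r)) ∨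
  (r % 4 = 3 ∧ ∃ v ∈ dagRound s.dag r, v.source = P.secondLeader (wave r)) ∨
  (r % 4 = 0 ∧ EnoughVotes P s r (getSecondLeader P s.dag (wave r))) ∨
  (r % 4 = 2 ∧ EnoughVotes P s r (getFirstLeader P s.dag (wave r)))

/-- First part of the handler of a legal delivery: try to add `v`. If this fails, put `v` into the
buffer; otherwise retry, in an arbitrary order `l`, the buffered vertices of rounds `≤ r`. -/
def AddDelivered (P : Params f n B) (i : Fin n) (v : Vertex n B) (r : ℕ)
    (s s' : LocalState n B) : Prop :=
  (∃ s₁, tryAddToDag P i s v = some (s₁, false) ∧ s' = { s₁ with buffer := insert v s₁.buffer }) ∨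
  (∃ s₁, tryAddToDag P i s v = some (s₁, true) ∧
    ∃ l : List (Vertex n B), l.Nodup ∧ (∀ u, u ∈ l ↔ u ∈ s₁.buffer ∧ u.round ≤ r) ∧
      l.foldlM (fun s u => (tryAddToDag P i s u).map Prod.fst) s₁ = some s')

/-- The handler of `r_deliver(v, r, p)`. -/
def OnDeliver (P : Params f n B) (i : Fin n) (v : Vertex n B) (r : ℕ) (p : Fin n)
    (s s' : LocalState n B) : Prop :=
  if Legal f v r p then
    ∃ s₁, AddDelivered P i v r s s₁ ∧
      if r = s₁.round ∧ AdvanceCondition P s₁ r then tryAdvanceRound P i s₁ = some s'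
      else s' = s₁
  else s' = s

/-! ### Executions -/

/-- The events at an honest party. -/
inductive LocalEvent (n : ℕ) (B : Type*) where
  /-- the party begins and broadcasts its vertex of round 1 -/
  | start
  /-- a call `a_bcast(b, r)` -/
  | aBcast (b : B) (r : ℕ)
  /-- an output `r_deliver(v, r, p)` of reliable broadcast -/
  | rDeliver (v : Vertex n B) (r : ℕ) (p : Fin n)
  /-- the timer expires -/
  | timeout

/-- The steps of honest party `i`. Handlers run atomically; a handler that needs a block completes
only after enough blocks have been enqueued. -/
inductive LocalStep (P : Params f n B) (i : Fin n) :
    LocalEvent n B → LocalState n B → LocalState n B → Prop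
  | start {s s' : LocalState n B} (h₀ : s.started = false)
      (h : broadcastVertex P i { s with started := true } 1 = some s') :
      LocalStep P i .start s s'
  | aBcast (b : B) (r : ℕ) (s : LocalState n B) :
      LocalStep P i (.aBcast b r) s { s with blocksToPropose := s.blocksToPropose ++ [b] }
  | rDeliver (v : Vertex n B) (r : ℕ) (p : Fin n) {s s' : LocalState n B} (h₀ : s.started = true)
      (h : OnDeliver P i v r p s s') :
      LocalStep P i (.rDeliver v r p) s s'
  | timeout {s s' : LocalState n B} (h₀ : s.started = true)
      (h : tryAdvanceRound P i { s with wait := false } = some s') :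
      LocalStep P i .timeout s s'

/-- An infinite execution in which the parties in `honest` follow the protocol. At each time at most
one event at one party happens. Message delays and timers are not restricted, and neither are the
states of, and the events at, the other (Byzantine) parties. -/
structure Execution (P : Params f n B) (honest : Finset (Fin n)) where
  event : ℕ → Option (Fin n × LocalEvent n B)
  state : ℕ → Fin n → LocalState n B
  state_zero : ∀ i ∈ honest, state 0 i = initialState P
  step : ∀ t, ∀ i ∈ honest, ∀ e, event t = some (i, e) →
    LocalStep P i e (state t i) (state (t + 1) i)
  idle : ∀ t, ∀ i ∈ honest, (∀ e, event t ≠ some (i, e)) → state (t + 1) i = state t i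

variable {P : Params f n B} {honest : Finset (Fin n)}

/-- Party `i` outputs `r_deliver(v, r, p)` at time `t`. -/
def Execution.DeliversAt (E : Execution P honest) (t : ℕ) (i : Fin n) (v : Vertex n B) (r : ℕ)
    (p : Fin n) : Prop :=
  E.event t = some (i, .rDeliver v r p)

/-- The guarantees of the reliable broadcast abstraction. -/
structure Execution.ReliableBroadcast (E : Execution P honest) : Prop where
  agreement : ∀ i ∈ honest, ∀ j ∈ honest, ∀ t v r p,
    E.DeliversAt t i v r p → ∃ t', E.DeliversAt t' j v r p
  integrity : ∀ i ∈ honest, ∀ r p t t' v v',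
    E.DeliversAt t i v r p → E.DeliversAt t' i v' r p → t = t'
  validity : ∀ k ∈ honest, ∀ t v r, (v, r) ∈ (E.state t k).sent →
    ∀ i ∈ honest, ∃ t', E.DeliversAt t' i v r k

/-- Party `i` outputs `a_deliver x` before `a_deliver y`. -/
def Execution.OutputsBefore (E : Execution P honest) (i : Fin n) (x y : B × ℕ × Fin n) : Prop :=
  ∃ t k l : ℕ, k < l ∧ (E.state t i).output[k]? = some x ∧ (E.state t i).output[l]? = some y

/-- Total order of atomic broadcast. -/
def Execution.TotalOrder (E : Execution P honest) : Prop :=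
  ∀ i ∈ honest, ∀ j ∈ honest, ∀ x y,
    E.OutputsBefore i x y → ¬ E.OutputsBefore j y x

end

end BullShark

namespace BullShark

noncomputable section

open scoped Classical

variable {f n : ℕ} {B : Type*}

/-! ### Vertices and local DAGs -/

/-! Let `W` be the set of all vertices that ever occur in the DAG of an honest party. Reliable
broadcast delivers each vertex of `W` of round at least 1 to every honest party, and integrity then
forbids two of them with the same round and source. So `W` is `Coherent`: no equivocation, closed
under edges, and at least `2f + 1` strong edges at each vertex of round at least 1.

A leader `l` is committed only if `f + 1` strong edges of some vertex two rounds later lead to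
vertices strongly reaching `l`. Each vertex of that later round has `2f + 1` strong edges into the
intermediate round, which holds at most `3f + 1` vertices of `W`. The two sets meet, so every vertex
of `W` at least two rounds above `l` strongly reaches `l` (`Certified.stronglyReaches`). Hence the
backward walk from any later leader passes through `l` and then repeats the walk from `l`: the chain
of `l` is a prefix of the chain of each later leader (`Certified.chain_eq`).

Local DAGs are closed under edges, so walks and causal histories do not depend on the party. The
invariant `Ordered` says that, once something is committed, the output is the delivery of the full
chain of one certified leader. It survives commits (`Ordered.commitLeader`) even when leaders are
popped again, since a history already delivered yields nothing new. Any two honest outputs, at any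
two times, are therefore comparable prefixes (`Ordered.prefix_or_prefix`) without repetitions, which
gives total order. -/

/-- The properties of the vertices of rounds `≥ 1` that honest parties add to their DAGs. -/
structure Proper (f : ℕ) (v : Vertex n B) : Prop where
  one_le_round : 1 ≤ v.round
  wellFormed : v.WellFormed
  card_strongEdges : 2 * f + 1 ≤ v.strongEdges.card

/-- Some strong edge exists and its target is one round lower, so the round is not 0. -/
theorem Legal.proper {v : Vertex n B} {r : ℕ} {p : Fin n} (h : Legal f v r p) : Proper f v := by
  obtain ⟨-, -, hc, hw⟩ := h
  refine ⟨?_, hw, hc⟩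
  obtain ⟨u, hu⟩ := Finset.card_pos.1 (show 0 < v.strongEdges.card by omega)
  have := hw.1 u hu
  omega

theorem mem_dagRound {dag : Finset (Vertex n B)} {r : ℕ} {v : Vertex n B} :
    v ∈ dagRound dag r ↔ v ∈ dag ∧ v.round = r := by
  simp [dagRound]

/-- Only the location of the weak edges matters for the order; that they reach everything missing
plays no role. -/
theorem newWeakEdges_spec (i : Fin n) (dag : Finset (Vertex n B)) (r : ℕ) (b : B) :
    ∀ u ∈ newWeakEdges i dag r b, u ∈ dag ∧ u.round + 1 < r := by
  have key : ∀ (l : List ℕ) (weak : Finset (Vertex n B)), (∀ k ∈ l, k + 1 < r) →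
      (∀ u ∈ weak, u ∈ dag ∧ u.round + 1 < r) →
      ∀ u ∈ l.foldl (fun weak k => weak ∪ (dagRound dag k).filter fun u =>
        ¬ Path dag (Vertex.mk r i b (dagRound dag (r - 1)).toList weak.toList) u) weak,
        u ∈ dag ∧ u.round + 1 < r := by
    intro l
    induction l with
    | nil => intro weak _ h; simpa using h
    | cons k l ih =>
      intro weak hl h
      rw [List.foldl_cons]
      refine ih _ (fun k' hk' => hl k' (List.mem_cons_of_mem _ hk')) ?_
      intro u hu
      rcases Finset.mem_union.1 hu with hu | hu
      · exact h u hu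
      · obtain ⟨hu, hr⟩ := mem_dagRound.1 (Finset.mem_filter.1 hu).1
        exact ⟨hu, hr ▸ hl k List.mem_cons_self⟩
  refine key _ _ ?_ (by simp)
  intro k hk
  simp only [List.mem_reverse, List.mem_map, List.mem_range] at hk
  omega

theorem newVertex_round (i : Fin n) (dag : Finset (Vertex n B)) (r : ℕ) (b : B) :
    (newVertex i dag r b).round = r := rfl

theorem newVertex_strongEdges (i : Fin n) (dag : Finset (Vertex n B)) (r : ℕ) (b : B) :
    (newVertex i dag r b).strongEdges = dagRound dag (r - 1) := by
  simp [newVertex, Vertex.strongEdges]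

theorem newVertex_weakEdges (i : Fin n) (dag : Finset (Vertex n B)) (r : ℕ) (b : B) :
    (newVertex i dag r b).weakEdges = newWeakEdges i dag r b := by
  simp [newVertex, Vertex.weakEdges]

theorem newVertex_proper (i : Fin n) (dag : Finset (Vertex n B)) {r : ℕ} (b : B) (hr : 1 ≤ r)
    (hc : 2 * f + 1 ≤ (dagRound dag (r - 1)).card) : Proper f (newVertex i dag r b) := by
  refine ⟨hr, ⟨?_, ?_⟩, ?_⟩
  · intro u hu
    rw [newVertex_strongEdges] at hu
    have := (mem_dagRound.1 hu).2
    rw [newVertex_round]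
    omega
  · intro u hu
    rw [newVertex_weakEdges] at hu
    exact (newWeakEdges_spec i dag r b u hu).2
  · rwa [newVertex_strongEdges]

theorem newVertex_ready (i : Fin n) (s : LocalState n B) (r : ℕ) (b : B) :
    Ready s (newVertex i s.dag r b) := by
  intro u hu
  rw [newVertex_strongEdges, newVertex_weakEdges] at hu
  rcases Finset.mem_union.1 hu with hu | hu
  · exact (mem_dagRound.1 hu).1
  · exact (newWeakEdges_spec i s.dag r b u hu).1

/-- Every vertex of a round `≥ 1` is proper, and its edges lead into the DAG. -/
def Sound (f : ℕ) (dag : Finset (Vertex n B)) : Prop :=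
  ∀ v ∈ dag, 1 ≤ v.round → Proper f v ∧ ∀ u ∈ v.strongEdges ∪ v.weakEdges, u ∈ dag

/-! ### Leaders -/

/-- The vertex is in the round of a predefined leader and has this leader as its source. -/
def IsLeader (P : Params f n B) (v : Vertex n B) : Prop :=
  (v.round % 4 = 1 ∧ v.source = P.firstLeader (wave v.round)) ∨
    (v.round % 4 = 3 ∧ v.source = P.secondLeader (wave v.round))

theorem IsLeader.odd {P : Params f n B} {v : Vertex n B} (h : IsLeader P v) : v.round % 2 = 1 := by
  rcases h with h | h <;> omega

theorem IsLeader.source_eq {P : Params f n B} {u v : Vertex n B} (hu : IsLeader P u)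
    (hv : IsLeader P v) (h : u.round = v.round) : u.source = v.source := by
  rcases hu with hu | hu <;> rcases hv with hv | hv
  · rw [hu.2, hv.2, h]
  · omega
  · omega
  · rw [hu.2, hv.2, h]

/-- The leader vertex of the odd round `r` in the DAG. -/
def leaderIn (P : Params f n B) (dag : Finset (Vertex n B)) (r : ℕ) : Option (Vertex n B) :=
  if r % 4 = 1 then getFirstLeader P dag (wave r) else getSecondLeader P dag (wave r)

theorem getVertex_spec {dag : Finset (Vertex n B)} {p : Fin n} {r : ℕ} {v : Vertex n B}
    (h : getVertex dag p r = some v) : v ∈ dag ∧ v.round = r ∧ v.source = p := by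
  unfold getVertex at h
  split_ifs at h with hex
  have hs := hex.choose_spec
  rw [Option.some.inj h] at hs
  exact ⟨(mem_dagRound.1 hs.1).1, (mem_dagRound.1 hs.1).2, hs.2⟩

/-- The lookup chooses among possibly several vertices, so it is identified with `v` only later,
through uniqueness in `W`. -/
theorem getVertex_ne_none {dag : Finset (Vertex n B)} {v : Vertex n B} (h : v ∈ dag) :
    getVertex dag v.source v.round ≠ none := by
  unfold getVertex
  rw [dif_pos ⟨v, mem_dagRound.2 ⟨h, rfl⟩, rfl⟩]
  exact Option.some_ne_none _

theorem getFirstLeader_spec {P : Params f n B} {dag : Finset (Vertex n B)} {w : ℕ}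
    {v : Vertex n B} (h : getFirstLeader P dag w = some v) :
    v ∈ dag ∧ 1 ≤ w ∧ v.round = 4 * w - 3 ∧ IsLeader P v := by
  unfold getFirstLeader at h
  split_ifs at h with hw
  obtain ⟨hv, hr, hs⟩ := getVertex_spec h
  refine ⟨hv, by omega, hr, Or.inl ⟨by omega, ?_⟩⟩
  rw [hs, hr, wave, show (4 * w - 3 + 3) / 4 = w by omega]

theorem getSecondLeader_spec {P : Params f n B} {dag : Finset (Vertex n B)} {w : ℕ}
    {v : Vertex n B} (h : getSecondLeader P dag w = some v) :
    v ∈ dag ∧ 1 ≤ w ∧ v.round = 4 * w - 1 ∧ IsLeader P v := by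
  unfold getSecondLeader at h
  split_ifs at h with hw
  obtain ⟨hv, hr, hs⟩ := getVertex_spec h
  refine ⟨hv, by omega, hr, Or.inr ⟨by omega, ?_⟩⟩
  rw [hs, hr, wave, show (4 * w - 1 + 3) / 4 = w by omega]

/-- Oddness is needed: for even `r` the second-leader branch looks into a different round. -/
theorem leaderIn_spec {P : Params f n B} {dag : Finset (Vertex n B)} {r : ℕ} {v : Vertex n B}
    (hr : r % 2 = 1) (h : leaderIn P dag r = some v) : v ∈ dag ∧ v.round = r ∧ IsLeader P v := by
  unfold leaderIn at h
  split_ifs at h with h4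
  · obtain ⟨hv, hw, hr', hl⟩ := getFirstLeader_spec h
    refine ⟨hv, ?_, hl⟩
    unfold wave at hr'
    omega
  · obtain ⟨hv, hw, hr', hl⟩ := getSecondLeader_spec h
    refine ⟨hv, ?_, hl⟩
    unfold wave at hr'
    omega

theorem leaderIn_ne_none {P : Params f n B} {dag : Finset (Vertex n B)} {v : Vertex n B}
    (hv : v ∈ dag) (hl : IsLeader P v) : leaderIn P dag v.round ≠ none := by
  have h := getVertex_ne_none hv
  unfold leaderIn
  rcases hl with ⟨h4, hs⟩ | ⟨h4, hs⟩
  · rw [if_pos h4, getFirstLeader, if_neg (by unfold wave; omega), ← hs,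
      show 4 * wave v.round - 3 = v.round by unfold wave; omega]
    exact h
  · rw [if_neg (by omega), getSecondLeader, if_neg (by unfold wave; omega), ← hs,
      show 4 * wave v.round - 1 = v.round by unfold wave; omega]
    exact h

/-! ### Decomposition of the handlers into elementary steps -/

/-- The elementary steps: admission of a vertex, changes that do not matter for the order, and the
commitment of a leader that has enough votes. -/
inductive MicroStep (P : Params f n B) : LocalState n B → LocalState n B → Prop
  | addVertex {s s' : LocalState n B} (v : Vertex n B) (hr : Ready s v) (hp : Proper f v)
      (hdag : s'.dag = insert v s.dag) (hc : s'.committedRound = s.committedRound)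
      (hd : s'.deliveredVertices = s.deliveredVertices) (ho : s'.output = s.output) :
      MicroStep P s s'
  | idle {s s' : LocalState n B}
      (hdag : s'.dag = s.dag) (hc : s'.committedRound = s.committedRound)
      (hd : s'.deliveredVertices = s.deliveredVertices) (ho : s'.output = s.output) :
      MicroStep P s s'
  | commit {s : LocalState n B} (v l : Vertex n B) (hv : v ∈ s.dag) (hl : l ∈ s.dag)
      (hL : IsLeader P l) (hr : v.round = l.round + 2)
      (hc : f + 1 ≤ (v.strongEdges.filter fun u => StrongPath s.dag u l).card) :
      MicroStep P s (commitLeader P s l)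

theorem orderVertices_frame (P : Params f n B) (stack : List (Vertex n B)) (s : LocalState n B) :
    (orderVertices P s stack).dag = s.dag ∧ (orderVertices P s stack).buffer = s.buffer ∧
      (orderVertices P s stack).sent = s.sent ∧
      (orderVertices P s stack).committedRound = s.committedRound := by
  induction stack generalizing s with
  | nil => exact ⟨rfl, rfl, rfl, rfl⟩
  | cons v l ih => exact ih (orderLeader P s v)

theorem commitLeader_frame (P : Params f n B) (s : LocalState n B) (v : Vertex n B) :
    (commitLeader P s v).dag = s.dag ∧ (commitLeader P s v).buffer = s.buffer ∧
      (commitLeader P s v).sent = s.sent := by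
  unfold commitLeader
  obtain ⟨h₁, h₂, h₃, -⟩ := orderVertices_frame P
    (leaderLoop P s.dag s.committedRound (v.round - 2) v [v]).2
    { s with committedRound :=
      (leaderLoop P s.dag s.committedRound (v.round - 2) v [v]).1.round }
  exact ⟨h₁, h₂, h₃⟩

theorem tryCommit_frame (P : Params f n B) (s : LocalState n B) (votes : Finset (Vertex n B))
    (o : Option (Vertex n B)) :
    (tryCommit P s votes o).dag = s.dag ∧ (tryCommit P s votes o).buffer = s.buffer ∧
      (tryCommit P s votes o).sent = s.sent := by
  cases o with
  | none => exact ⟨rfl, rfl, rfl⟩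
  | some v =>
    unfold tryCommit
    dsimp only
    split_ifs
    · exact commitLeader_frame P s v
    · exact ⟨rfl, rfl, rfl⟩

theorem tryOrdering_frame (P : Params f n B) (s : LocalState n B) (v : Vertex n B) :
    (tryOrdering P s v).dag = s.dag ∧ (tryOrdering P s v).buffer = s.buffer ∧
      (tryOrdering P s v).sent = s.sent := by
  unfold tryOrdering
  split_ifs
  · exact tryCommit_frame _ _ _ _
  · exact tryCommit_frame _ _ _ _
  · exact ⟨rfl, rfl, rfl⟩

theorem MicroStep.dag_subset {P : Params f n B} {s s' : LocalState n B} (h : MicroStep P s s') :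
    s.dag ⊆ s'.dag := by
  cases h with
  | addVertex v hr hp hdag => rw [hdag]; exact Finset.subset_insert _ _
  | idle hdag => rw [hdag]
  | commit v l => rw [(commitLeader_frame P s l).1]

theorem dag_subset_of_steps {P : Params f n B} {s s' : LocalState n B}
    (h : Relation.ReflTransGen (MicroStep P) s s') : s.dag ⊆ s'.dag := by
  induction h with
  | refl => exact Finset.Subset.refl _
  | tail _ h ih => exact ih.trans h.dag_subset

theorem MicroStep.sound {P : Params f n B} {s s' : LocalState n B} (h : MicroStep P s s')
    (hs : Sound f s.dag) : Sound f s'.dag := by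
  cases h with
  | addVertex v hr hp hdag =>
    rw [hdag]
    intro u hu h1
    rcases Finset.mem_insert.1 hu with rfl | hu
    · exact ⟨hp, fun x hx => Finset.mem_insert_of_mem (hr x hx)⟩
    · exact ⟨(hs u hu h1).1, fun x hx => Finset.mem_insert_of_mem ((hs u hu h1).2 x hx)⟩
  | idle hdag => rwa [hdag]
  | commit v l => rwa [(commitLeader_frame P s l).1]

theorem sound_of_steps {P : Params f n B} {s s' : LocalState n B}
    (h : Relation.ReflTransGen (MicroStep P) s s') (hs : Sound f s.dag) : Sound f s'.dag := by
  induction h with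
  | refl => exact hs
  | tail _ h ih => exact h.sound ih

theorem steps_tryCommit {P : Params f n B} {s : LocalState n B} {v : Vertex n B}
    {o : Option (Vertex n B)} (hv : v ∈ s.dag)
    (ho : ∀ l, o = some l → l ∈ s.dag ∧ IsLeader P l ∧ v.round = l.round + 2) :
    Relation.ReflTransGen (MicroStep P) s (tryCommit P s v.strongEdges o) := by
  cases o with
  | none => exact .refl
  | some l =>
    obtain ⟨hl, hL, hr⟩ := ho l rfl
    unfold tryCommit
    dsimp only
    split_ifs with hc
    · exact .single (.commit v l hv hl hL hr hc)
    · exact .refl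

/-- In both branches the leader lies exactly two rounds below `v`, also across the wave boundary, so
a single kind of commit step suffices. -/
theorem steps_tryOrdering {P : Params f n B} {s : LocalState n B} {v : Vertex n B}
    (hv : v ∈ s.dag) : Relation.ReflTransGen (MicroStep P) s (tryOrdering P s v) := by
  unfold tryOrdering
  split_ifs with h₁ h₃
  · refine steps_tryCommit hv fun l hl => ?_
    obtain ⟨hl, hw, hr, hL⟩ := getSecondLeader_spec hl
    refine ⟨hl, hL, ?_⟩
    unfold wave at hr hw
    omega
  · refine steps_tryCommit hv fun l hl => ?_
    obtain ⟨hl, hw, hr, hL⟩ := getFirstLeader_spec hl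
    refine ⟨hl, hL, ?_⟩
    unfold wave at hr hw
    omega
  · exact .refl

/-- Party `i` passes from `s` to `s'` by elementary steps, and the vertices that it adds or
buffers are in `D` or are its own and sent. -/
structure Evolves (P : Params f n B) (i : Fin n) (D : Set (Vertex n B))
    (s s' : LocalState n B) : Prop where
  steps : Relation.ReflTransGen (MicroStep P) s s'
  sent : ∀ x ∈ s.sent, x ∈ s'.sent
  origin : ∀ v ∈ s'.dag, v ∈ s.dag ∨ v ∈ D ∨ (v.source = i ∧ (v, v.round) ∈ s'.sent)
  buffer : ∀ v ∈ s'.buffer, v ∈ s.buffer ∨ v ∈ D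

variable {P : Params f n B} {i : Fin n} {D : Set (Vertex n B)}

theorem Evolves.trans {s₁ s₂ s₃ : LocalState n B} (h : Evolves P i D s₁ s₂)
    (h' : Evolves P i D s₂ s₃) : Evolves P i D s₁ s₃ := by
  refine ⟨h.steps.trans h'.steps, fun x hx => h'.sent x (h.sent x hx), fun v hv => ?_,
    fun v hv => ?_⟩
  · rcases h'.origin v hv with hv | hv | hv
    · rcases h.origin v hv with hv | hv | hv
      · exact Or.inl hv
      · exact Or.inr (Or.inl hv)
      · exact Or.inr (Or.inr ⟨hv.1, h'.sent _ hv.2⟩)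
    · exact Or.inr (Or.inl hv)
    · exact Or.inr (Or.inr hv)
  · rcases h'.buffer v hv with hv | hv
    · exact h.buffer v hv
    · exact Or.inr hv

/-- A change of the local state that concerns neither the DAG nor the order. -/
theorem Evolves.of_eq {s s' : LocalState n B} (hdag : s'.dag = s.dag)
    (hc : s'.committedRound = s.committedRound)
    (hd : s'.deliveredVertices = s.deliveredVertices) (ho : s'.output = s.output)
    (hs : s'.sent = s.sent) (hb : ∀ v ∈ s'.buffer, v ∈ s.buffer ∨ v ∈ D) : Evolves P i D s s' :=
  ⟨.single (.idle hdag hc hd ho), fun _ hx => hs ▸ hx, fun _ hv => Or.inl (hdag ▸ hv), hb⟩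

theorem Evolves.refl (s : LocalState n B) : Evolves P i D s s :=
  .of_eq rfl rfl rfl rfl rfl fun _ hv => Or.inl hv

theorem Evolves.tryOrdering {s : LocalState n B} {v : Vertex n B} (hv : v ∈ s.dag) :
    Evolves P i D s (tryOrdering P s v) := by
  obtain ⟨h₁, h₂, h₃⟩ := tryOrdering_frame P s v
  exact ⟨steps_tryOrdering hv, fun x hx => h₃ ▸ hx, fun v hv => Or.inl (h₁ ▸ hv),
    fun v hv => Or.inl (h₂ ▸ hv)⟩

/-! ### The handlers as sequences of elementary steps -/

theorem tryAddNoJump_of_ready {s : LocalState n B} {v : Vertex n B} (h : Ready s v) :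
    tryAddNoJump P s v =
      tryOrdering P { s with dag := insert v s.dag, buffer := s.buffer.erase v } v :=
  if_pos h

theorem Evolves.broadcastVertex {s s' : LocalState n B} {r : ℕ} (hr : 1 ≤ r)
    (hc : 2 * f + 1 ≤ (dagRound s.dag (r - 1)).card)
    (h : broadcastVertex P i s r = some s') : Evolves P i D s s' := by
  unfold BullShark.broadcastVertex at h
  split at h
  · exact absurd h (Option.some_ne_none _).symm
  · rename_i b rest heq
    have hready : Ready { s with blocksToPropose := rest } (newVertex i s.dag r b) :=
      newVertex_ready i s r b
    dsimp only at h
    rw [tryAddNoJump_of_ready hready] at h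
    obtain rfl := Option.some.inj h
    set v := newVertex i s.dag r b with hv
    set s₀ : LocalState n B :=
      { s with blocksToPropose := rest, dag := insert v s.dag, buffer := s.buffer.erase v }
    obtain ⟨h₁, h₂, h₃⟩ := tryOrdering_frame P s₀ v
    refine ⟨?_, ?_, ?_, ?_⟩
    -- Admission of the new vertex, then ordering; the closing idle step absorbs the record in
    -- `sent`.
    · refine .trans (.single (b := s₀) ?_) (.trans (steps_tryOrdering (v := v) ?_) (.single ?_))
      · exact .addVertex v hready (newVertex_proper i s.dag b hr hc) rfl rfl rfl rfl
      · exact Finset.mem_insert_self _ _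
      · exact .idle rfl rfl rfl rfl
    · intro x hx
      exact List.mem_append_left _ (h₃ ▸ hx)
    · intro u hu
      have hu : u ∈ insert v s.dag := by
        have := h₁ ▸ hu
        exact this
      rcases Finset.mem_insert.1 hu with rfl | hu
      · exact Or.inr (Or.inr ⟨rfl, List.mem_append_right _ (by simp [hv, newVertex_round])⟩)
      · exact Or.inl hu
    · intro u hu
      have hu : u ∈ s.buffer.erase v := by
        have := h₂ ▸ hu
        exact this
      exact Or.inl (Finset.mem_of_mem_erase hu)

/-- A jump inserts the party's own broadcast, with its own ordering, between the admission of `v`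
and the ordering triggered by `v`; the pieces are composed in that sequence. -/
theorem Evolves.tryAddToDag {s : LocalState n B} {v : Vertex n B} {x : LocalState n B × Bool}
    (hv : v ∈ D) (hp : Proper f v) (h : tryAddToDag P i s v = some x) :
    Evolves P i D s x.1 := by
  unfold BullShark.tryAddToDag at h
  split_ifs at h with hready
  · have hbind : ∃ s₂, (if 2 * f + 1 ≤ (dagRound (insert v s.dag) v.round).card ∧
          s.round < v.round then
        BullShark.broadcastVertex P i
          { s with dag := insert v s.dag, round := v.round, wait := true } v.round
        else some { s with dag := insert v s.dag }) = some s₂ ∧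
        (BullShark.tryOrdering P { s₂ with buffer := s₂.buffer.erase v } v, true) = x := by
      dsimp only at h
      split_ifs at h ⊢ with hj
      · obtain ⟨s₂, h₂, h⟩ := Option.bind_eq_some_iff.1 h
        exact ⟨s₂, h₂, Option.some.inj h⟩
      · exact ⟨_, rfl, Option.some.inj h⟩
    obtain ⟨s₂, h₂, rfl⟩ := hbind
    have e₁ : Evolves P i D s { s with dag := insert v s.dag } :=
      ⟨.single (.addVertex v hready hp rfl rfl rfl rfl), fun _ hx => hx, fun u hu => by
        rcases Finset.mem_insert.1 hu with rfl | hu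
        · exact Or.inr (Or.inl hv)
        · exact Or.inl hu, fun _ hu => Or.inl hu⟩
    have e₂ : Evolves P i D { s with dag := insert v s.dag } s₂ := by
      split_ifs at h₂ with hj
      -- The vertex broadcast on a jump gets enough strong edges because those of `v` itself already
      -- lie in the DAG.
      · have hc : 2 * f + 1 ≤ (dagRound (insert v s.dag) (v.round - 1)).card := by
          refine hp.card_strongEdges.trans (Finset.card_le_card fun u hu => ?_)
          refine mem_dagRound.2 ⟨Finset.mem_insert_of_mem
            (hready u (Finset.mem_union_left _ hu)), ?_⟩
          have := hp.wellFormed.1 u hu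
          omega
        refine Evolves.trans
          (s₂ := { s with dag := insert v s.dag, round := v.round, wait := true })
          (.of_eq rfl rfl rfl rfl rfl fun _ hu => Or.inl hu) ?_
        exact Evolves.broadcastVertex hp.one_le_round hc h₂
      · rw [← Option.some.inj h₂]
        exact .refl _
    have e₃ : Evolves P i D s₂ { s₂ with buffer := s₂.buffer.erase v } :=
      .of_eq rfl rfl rfl rfl rfl fun _ hu => Or.inl (Finset.mem_of_mem_erase hu)
    refine ((e₁.trans e₂).trans e₃).trans (.tryOrdering ?_)
    exact dag_subset_of_steps e₂.steps (Finset.mem_insert_self _ _)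
  · rw [← Option.some.inj h]
    exact .refl _

/-- The list is fixed in advance while the buffer changes during the retries. This is harmless: only
membership in `D` is used. -/
theorem Evolves.retry {l : List (Vertex n B)} (hl : ∀ u ∈ l, u ∈ D) (hD : ∀ u ∈ D, Proper f u)
    {s s' : LocalState n B}
    (h : l.foldlM (fun s u => (BullShark.tryAddToDag P i s u).map Prod.fst) s = some s') :
    Evolves P i D s s' := by
  induction l generalizing s with
  | nil =>
    rw [List.foldlM_nil] at h
    rw [← Option.some.inj h]
    exact .refl _
  | cons u l ih =>
    rw [List.foldlM_cons, Option.bind_eq_bind, Option.bind_eq_some_iff] at h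
    obtain ⟨s₁, h₁, h⟩ := h
    obtain ⟨x, hx, rfl⟩ := Option.map_eq_some_iff.1 h₁
    have hu := hl u List.mem_cons_self
    exact (Evolves.tryAddToDag hu (hD u hu) hx).trans
      (ih (fun y hy => hl y (List.mem_cons_of_mem _ hy)) h)

theorem Evolves.tryAdvanceRound {s s' : LocalState n B} (h : tryAdvanceRound P i s = some s') :
    Evolves P i D s s' := by
  unfold BullShark.tryAdvanceRound at h
  split_ifs at h with hc
  · refine Evolves.trans (s₂ := { s with round := s.round + 1, wait := true })
      (.of_eq rfl rfl rfl rfl rfl fun _ hu => Or.inl hu) ?_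
    exact Evolves.broadcastVertex (by omega) (by simpa using hc) h
  · rw [← Option.some.inj h]
    exact .refl _

theorem Evolves.onDeliver {s s' : LocalState n B} {v : Vertex n B} {r : ℕ} {p : Fin n}
    (hb : ∀ u ∈ s.buffer, u ∈ D) (hD : ∀ u ∈ D, Proper f u) (hv : Legal f v r p → v ∈ D)
    (h : OnDeliver P i v r p s s') : Evolves P i D s s' := by
  unfold OnDeliver at h
  split_ifs at h with hL
  · obtain ⟨s₁, ha, h⟩ := h
    have hvD := hv hL
    have e : Evolves P i D s s₁ := by
      rcases ha with ⟨s₂, h₂, rfl⟩ | ⟨s₂, h₂, l, -, hl, h₃⟩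
      · refine (Evolves.tryAddToDag hvD (hD v hvD) h₂).trans ?_
        refine .of_eq rfl rfl rfl rfl rfl fun u hu => ?_
        rcases Finset.mem_insert.1 hu with rfl | hu
        · exact Or.inr hvD
        · exact Or.inl hu
      · have e₂ := Evolves.tryAddToDag hvD (hD v hvD) h₂
        refine e₂.trans (Evolves.retry (fun u hu => ?_) hD h₃)
        rcases e₂.buffer u ((hl u).1 hu).1 with hu | hu
        · exact hb u hu
        · exact hu
    split_ifs at h with hadv
    · exact e.trans (Evolves.tryAdvanceRound h)
    · rwa [h]
  · rw [h]
    exact .refl _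

theorem Evolves.localStep {s s' : LocalState n B} {e : LocalEvent n B}
    (hg : P.genesis ⊆ s.dag) (hb : ∀ u ∈ s.buffer, u ∈ D) (hD : ∀ u ∈ D, Proper f u)
    (hv : ∀ v r p, e = .rDeliver v r p → Legal f v r p → v ∈ D)
    (h : LocalStep P i e s s') : Evolves P i D s s' := by
  cases h with
  | start h₀ h =>
    refine Evolves.trans (s₂ := { s with started := true })
      (.of_eq rfl rfl rfl rfl rfl fun _ hu => Or.inl hu) ?_
    refine Evolves.broadcastVertex le_rfl ?_ h
    -- The genesis vertices are the `2f + 1` strong edges required in round 1.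
    rw [← P.genesis_card]
    exact Finset.card_le_card fun u hu => mem_dagRound.2 ⟨hg hu, P.genesis_round u hu⟩
  | aBcast b r => exact .of_eq rfl rfl rfl rfl rfl fun _ hu => Or.inl hu
  | rDeliver v r p h₀ h => exact Evolves.onDeliver hb hD (hv v r p rfl) h
  | timeout h₀ h =>
    refine Evolves.trans (s₂ := { s with wait := false })
      (.of_eq rfl rfl rfl rfl rfl fun _ hu => Or.inl hu) ?_
    exact Evolves.tryAdvanceRound h

/-! ### Reachability independently of a local DAG -/

/-- There is a path from `v` to `u` whose vertices after `v` are of rounds `≥ 1`. -/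
def Reaches (v u : Vertex n B) : Prop :=
  Relation.ReflTransGen (fun a b => 1 ≤ b.round ∧ (b ∈ a.strongEdges ∨ b ∈ a.weakEdges)) v u

/-- The same with strong edges only. -/
def StronglyReaches (v u : Vertex n B) : Prop :=
  Relation.ReflTransGen (fun a b => 1 ≤ b.round ∧ b ∈ a.strongEdges) v u

theorem StrongPath.stronglyReaches {dag : Finset (Vertex n B)} {v u : Vertex n B}
    (h : StrongPath dag v u) : StronglyReaches v u :=
  Relation.ReflTransGen.mono (fun _ _ h => h.2) _ _ h

/-- No path starting inside a sound DAG can leave it, so all parties holding `v` see the same causal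
history. The bound on rounds keeps paths away from the edges of genesis vertices, about which
nothing is assumed. -/
theorem Sound.path_of_reaches {dag : Finset (Vertex n B)} (hs : Sound f dag) {v u : Vertex n B}
    (hv : v ∈ dag) (hr : 1 ≤ v.round) (h : Reaches v u) :
    Path dag v u ∧ u ∈ dag ∧ 1 ≤ u.round := by
  induction h with
  | refl => exact ⟨.refl, hv, hr⟩
  | tail _ h ih =>
    obtain ⟨hp, hb, h1⟩ := ih
    have hc := (hs _ hb h1).2 _ (Finset.mem_union.2 h.2)
    exact ⟨hp.tail ⟨hc, h.1, h.2⟩, hc, h.1⟩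

theorem Sound.strongPath_of_stronglyReaches {dag : Finset (Vertex n B)} (hs : Sound f dag)
    {v u : Vertex n B} (hv : v ∈ dag) (hr : 1 ≤ v.round) (h : StronglyReaches v u) :
    StrongPath dag v u ∧ u ∈ dag ∧ 1 ≤ u.round := by
  induction h with
  | refl => exact ⟨.refl, hv, hr⟩
  | tail _ h ih =>
    obtain ⟨hp, hb, h1⟩ := ih
    have hc := (hs _ hb h1).2 _ (Finset.mem_union_left _ h.2)
    exact ⟨hp.tail ⟨hc, h.1, h.2⟩, hc, h.1⟩

/-! ### The vertices of all honest parties -/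

/-- A set of vertices without equivocation, closed under edges. -/
structure Coherent (f : ℕ) (W : Set (Vertex n B)) : Prop where
  proper : ∀ v ∈ W, 1 ≤ v.round → Proper f v
  edges : ∀ v ∈ W, 1 ≤ v.round → ∀ u ∈ v.strongEdges ∪ v.weakEdges, u ∈ W
  unique : ∀ u ∈ W, ∀ v ∈ W, 1 ≤ u.round → u.round = v.round → u.source = v.source → u = v

variable {W : Set (Vertex n B)}

theorem Coherent.mem_of_reaches (hW : Coherent f W) {v u : Vertex n B} (hv : v ∈ W)
    (hr : 1 ≤ v.round) (h : Reaches v u) : u ∈ W ∧ 1 ≤ u.round := by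
  induction h with
  | refl => exact ⟨hv, hr⟩
  | tail _ h ih => exact ⟨hW.edges _ ih.1 ih.2 _ (Finset.mem_union.2 h.2), h.1⟩

theorem Coherent.leader_unique (hW : Coherent f W) {u v : Vertex n B} (hu : u ∈ W) (hv : v ∈ W)
    (hlu : IsLeader P u) (hlv : IsLeader P v) (h : u.round = v.round) : u = v :=
  hW.unique u hu v hv (by have := hlu.odd; omega) h (hlu.source_eq hlv h)

/-- The leader vertex has the votes of `f + 1` strong edges of some vertex of `W`. -/
structure Certified (P : Params f n B) (W : Set (Vertex n B)) (l : Vertex n B) : Prop where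
  mem : l ∈ W
  isLeader : IsLeader P l
  votes : ∃ v ∈ W, v.round = l.round + 2 ∧
    f + 1 ≤ (v.strongEdges.filter fun u => StronglyReaches u l).card

theorem Certified.one_le_round {l : Vertex n B} (h : Certified P W l) : 1 ≤ l.round := by
  have := h.isLeader.odd
  omega

/-- Quorum intersection in the round just above `l`, then descent along arbitrary strong edges for
the higher rounds. -/
theorem Certified.stronglyReaches (hn : n = 3 * f + 1) (hW : Coherent f W) {l : Vertex n B}
    (hl : Certified P W l) (k : ℕ) :
    ∀ v ∈ W, v.round = l.round + 2 + k → StronglyReaches v l := by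
  induction k with
  | zero =>
    intro v hv hr
    obtain ⟨v', hv', hr', hc⟩ := hl.votes
    have hp := hW.proper v hv (by omega)
    have hp' := hW.proper v' hv' (by omega)
    set S := v'.strongEdges.filter fun u => StronglyReaches u l
    have hSs : ∀ u ∈ S, u ∈ W ∧ u.round = l.round + 1 := by
      intro u hu
      have hu := (Finset.mem_filter.1 hu).1
      have := hp'.wellFormed.1 u hu
      exact ⟨hW.edges v' hv' (by omega) u (Finset.mem_union_left _ hu), by omega⟩
    have hTs : ∀ u ∈ v.strongEdges, u ∈ W ∧ u.round = l.round + 1 := by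
      intro u hu
      have := hp.wellFormed.1 u hu
      exact ⟨hW.edges v hv (by omega) u (Finset.mem_union_left _ hu), by omega⟩
    have hinter : (S ∩ v.strongEdges).Nonempty := by
      by_contra hne
      rw [Finset.not_nonempty_iff_eq_empty] at hne
      -- Without equivocation, the source is injective on the vertices of one round.
      have hcard : (S ∪ v.strongEdges).card ≤ n := by
        have hinj : Set.InjOn Vertex.source (↑(S ∪ v.strongEdges) : Set (Vertex n B)) := by
          have hU : ∀ u ∈ S ∪ v.strongEdges, u ∈ W ∧ u.round = l.round + 1 := by
            intro u hu
            rcases Finset.mem_union.1 hu with hu | hu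
            · exact hSs u hu
            · exact hTs u hu
          intro a ha b hb hab
          obtain ⟨ha, hra⟩ := hU a ha
          obtain ⟨hb, hrb⟩ := hU b hb
          exact hW.unique a ha b hb (by omega) (by omega) hab
        have := Finset.card_le_card_of_injOn (t := Finset.univ) Vertex.source
          (fun _ _ => Finset.mem_coe.2 (Finset.mem_univ _)) hinj
        simpa using this
      -- Disjointness would give `(f + 1) + (2f + 1) = 3f + 2 > n` vertices in one round.
      have := Finset.card_union_add_card_inter S v.strongEdges
      rw [hne, Finset.card_empty] at this
      have := hp.card_strongEdges
      omega
    obtain ⟨u, hu⟩ := hinter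
    obtain ⟨huS, huv⟩ := Finset.mem_inter.1 hu
    exact .head ⟨by have := (hSs u huS).2; omega, huv⟩ (Finset.mem_filter.1 huS).2
  | succ k ih =>
    intro v hv hr
    have hp := hW.proper v hv (by omega)
    obtain ⟨u, hu⟩ := Finset.card_pos.1
      (show 0 < v.strongEdges.card by have := hp.card_strongEdges; omega)
    have := hp.wellFormed.1 u hu
    exact .head ⟨by omega, hu⟩
      (ih u (hW.edges v hv (by omega) u (Finset.mem_union_left _ hu)) (by omega))

/-! ### The chain of leaders below a leader -/

/-- The leader vertex of round `r` in `W`. -/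
def globalLeader (P : Params f n B) (W : Set (Vertex n B)) (r : ℕ) : Option (Vertex n B) :=
  if h : ∃ u ∈ W, IsLeader P u ∧ u.round = r then some h.choose else none

theorem globalLeader_spec {r : ℕ} {u : Vertex n B} (h : globalLeader P W r = some u) :
    u ∈ W ∧ IsLeader P u ∧ u.round = r := by
  unfold globalLeader at h
  split_ifs at h with hex
  rw [← Option.some.inj h]
  exact hex.choose_spec

theorem Coherent.globalLeader_eq (hW : Coherent f W) {u : Vertex n B} (hu : u ∈ W)
    (hl : IsLeader P u) : globalLeader P W u.round = some u := by
  have hex : ∃ u' ∈ W, IsLeader P u' ∧ u'.round = u.round := ⟨u, hu, hl, rfl⟩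
  unfold globalLeader
  rw [dif_pos hex]
  obtain ⟨h₁, h₂, h₃⟩ := hex.choose_spec
  rw [hW.leader_unique h₁ hu h₂ hl h₃]

/-- The leaders of rounds `≤ r` and `> c` that are committed together with `v`, oldest first. -/
def chainBelow (P : Params f n B) (W : Set (Vertex n B)) (c r : ℕ) (v : Vertex n B) :
    List (Vertex n B) :=
  if _h : c < r then
    match globalLeader P W r with
    | some u =>
      if StronglyReaches v u then chainBelow P W c (r - 2) u ++ [u]
      else chainBelow P W c (r - 2) v
    | none => chainBelow P W c (r - 2) v
  else []
termination_by r
decreasing_by all_goals omega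

/-- The leaders of rounds `> c` that are committed together with `l`, and `l`, oldest first. -/
def chain (P : Params f n B) (W : Set (Vertex n B)) (c : ℕ) (l : Vertex n B) :
    List (Vertex n B) :=
  chainBelow P W c (l.round - 2) l ++ [l]

theorem chainBelow_of_le {c r : ℕ} (h : r ≤ c) (v : Vertex n B) :
    chainBelow P W c r v = [] := by
  rw [chainBelow, dif_neg (by omega)]

theorem chainBelow_of_some {c r : ℕ} {u v : Vertex n B} (h : c < r)
    (hu : globalLeader P W r = some u) (hvu : StronglyReaches v u) :
    chainBelow P W c r v = chainBelow P W c (r - 2) u ++ [u] := by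
  rw [chainBelow, dif_pos h, hu]
  exact if_pos hvu

theorem chainBelow_of_not {c r : ℕ} {v : Vertex n B} (h : c < r)
    (hu : ∀ u, globalLeader P W r = some u → ¬ StronglyReaches v u) :
    chainBelow P W c r v = chainBelow P W c (r - 2) v := by
  rw [chainBelow, dif_pos h]
  split
  · rename_i u heq
    exact if_neg (hu u heq)
  · rfl

/-- The two ways in which the loop proceeds. -/
theorem chainBelow_cases (P : Params f n B) (W : Set (Vertex n B)) (r : ℕ) (v : Vertex n B) :
    (∃ u, globalLeader P W r = some u ∧ StronglyReaches v u) ∨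
      ∀ u, globalLeader P W r = some u → ¬ StronglyReaches v u := by
  by_cases h : ∃ u, globalLeader P W r = some u ∧ StronglyReaches v u
  · exact Or.inl h
  · exact Or.inr fun u hu hvu => h ⟨u, hu, hvu⟩

theorem mem_chainBelow {c r : ℕ} {u v : Vertex n B} (h : u ∈ chainBelow P W c r v) :
    u ∈ W ∧ 1 ≤ u.round ∧ u.round ≤ r := by
  induction r using Nat.strong_induction_on generalizing v with
  | _ r ih =>
    by_cases hc : c < r
    · rcases chainBelow_cases P W r v with ⟨x, hx, hvx⟩ | hx
      · rw [chainBelow_of_some hc hx hvx] at h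
        rcases List.mem_append.1 h with h | h
        · have := ih (r - 2) (by omega) h
          exact ⟨this.1, this.2.1, by omega⟩
        · obtain ⟨hW, hl, hr⟩ := globalLeader_spec hx
          rw [List.mem_singleton.1 h]
          exact ⟨hW, by have := hl.odd; omega, by omega⟩
      · rw [chainBelow_of_not hc hx] at h
        have := ih (r - 2) (by omega) h
        exact ⟨this.1, this.2.1, by omega⟩
    · rw [chainBelow_of_le (by omega)] at h
      exact absurd h List.not_mem_nil

/-- Each leader picked is strongly reached from the previous one, hence present in any sound DAG
that holds the start. -/
theorem mem_dag_of_mem_chainBelow {dag : Finset (Vertex n B)} (hs : Sound f dag) {c r : ℕ}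
    {u v : Vertex n B} (hv : v ∈ dag) (hr : 1 ≤ v.round) (h : u ∈ chainBelow P W c r v) :
    u ∈ dag := by
  induction r using Nat.strong_induction_on generalizing v with
  | _ r ih =>
    by_cases hc : c < r
    · rcases chainBelow_cases P W r v with ⟨x, hx, hvx⟩ | hx
      · rw [chainBelow_of_some hc hx hvx] at h
        obtain ⟨-, hxd, hx1⟩ := hs.strongPath_of_stronglyReaches hv hr hvx
        rcases List.mem_append.1 h with h | h
        · exact ih (r - 2) (by omega) hxd hx1 h
        · rwa [List.mem_singleton.1 h]
      · rw [chainBelow_of_not hc hx] at h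
        exact ih (r - 2) (by omega) hv hr h
    · rw [chainBelow_of_le (by omega)] at h
      exact absurd h List.not_mem_nil

theorem mem_chain {c : ℕ} {l u : Vertex n B} (hl : l ∈ W) (h1 : 1 ≤ l.round)
    (h : u ∈ chain P W c l) : u ∈ W ∧ 1 ≤ u.round := by
  rcases List.mem_append.1 h with h | h
  · exact ⟨(mem_chainBelow h).1, (mem_chainBelow h).2.1⟩
  · rw [List.mem_singleton.1 h]
    exact ⟨hl, h1⟩

/-- The cutoff decides where the walk stops, never which leaders it picks before that. -/
theorem chainBelow_eq_append (c r : ℕ) (v : Vertex n B) :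
    ∃ pre, chainBelow P W 0 r v = pre ++ chainBelow P W c r v ∧ ∀ u ∈ pre, u.round ≤ c := by
  induction r using Nat.strong_induction_on generalizing v with
  | _ r ih =>
    by_cases hc : c < r
    · rcases chainBelow_cases P W r v with ⟨x, hx, hvx⟩ | hx
      · obtain ⟨pre, h, hpre⟩ := ih (r - 2) (by omega) x
        refine ⟨pre, ?_, hpre⟩
        rw [chainBelow_of_some hc hx hvx, chainBelow_of_some (by omega) hx hvx, h,
          List.append_assoc]
      · obtain ⟨pre, h, hpre⟩ := ih (r - 2) (by omega) v
        refine ⟨pre, ?_, hpre⟩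
        rw [chainBelow_of_not hc hx, chainBelow_of_not (by omega) hx, h]
    · refine ⟨chainBelow P W 0 r v, ?_, fun u hu => ?_⟩
      · rw [chainBelow_of_le (c := c) (by omega), List.append_nil]
      · have := (mem_chainBelow hu).2.2
        omega

theorem chain_eq_append (c : ℕ) (l : Vertex n B) :
    ∃ pre, chain P W 0 l = pre ++ chain P W c l ∧ ∀ u ∈ pre, u.round ≤ c := by
  obtain ⟨pre, h, hpre⟩ := chainBelow_eq_append (P := P) (W := W) c (l.round - 2) l
  exact ⟨pre, by rw [chain, h, List.append_assoc, chain], hpre⟩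

/-- When the walk arrives at the round of `l`, its current leader is at least two rounds higher and
so strongly reaches `l`. Thus `l` is picked, and the remaining walk is the one from `l`. -/
theorem Certified.chainBelow_eq (hn : n = 3 * f + 1) (hW : Coherent f W) {l : Vertex n B}
    (hl : Certified P W l) {r : ℕ} {v : Vertex n B} (hv : v ∈ W) (hvr : r + 2 ≤ v.round)
    (hr : l.round ≤ r) (hodd : r % 2 = 1) :
    ∃ rest, chainBelow P W 0 r v = chain P W 0 l ++ rest ∧ ∀ u ∈ rest, l.round < u.round := by
  induction r using Nat.strong_induction_on generalizing v with
  | _ r ih =>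
    have hlo := hl.isLeader.odd
    have h1 := hl.one_le_round
    rcases Nat.eq_or_lt_of_le hr with rfl | hlt
    · refine ⟨[], ?_, by simp⟩
      have := hl.stronglyReaches hn hW (v.round - (l.round + 2)) v hv (by omega)
      rw [chainBelow_of_some (by omega) (hW.globalLeader_eq hl.mem hl.isLeader) this, chain,
        List.append_nil]
    · rcases chainBelow_cases P W r v with ⟨x, hx, hvx⟩ | hx
      · obtain ⟨hxW, hxl, hxr⟩ := globalLeader_spec hx
        -- Both rounds are odd, so a step of two cannot skip the round of `l`.
        obtain ⟨rest, h, hrest⟩ := ih (r - 2) (by omega) hxW (by omega) (by omega) (by omega)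
        refine ⟨rest ++ [x], ?_, ?_⟩
        · rw [chainBelow_of_some (by omega) hx hvx, h, List.append_assoc]
        · intro u hu
          rcases List.mem_append.1 hu with hu | hu
          · exact hrest u hu
          · rw [List.mem_singleton.1 hu]
            omega
      · rw [chainBelow_of_not (by omega) hx]
        exact ih (r - 2) (by omega) hv (by omega) (by omega) (by omega)

/-- Only the lower leader needs votes. The strict bound on `rest` separates the leaders new in the
longer chain from those that a cutoff may omit. -/
theorem Certified.chain_eq (hn : n = 3 * f + 1) (hW : Coherent f W) {l l' : Vertex n B}
    (hl : Certified P W l) (hl' : l' ∈ W) (hL' : IsLeader P l') (hr : l.round ≤ l'.round) :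
    ∃ rest, chain P W 0 l' = chain P W 0 l ++ rest ∧ ∀ u ∈ rest, l.round < u.round := by
  rcases Nat.eq_or_lt_of_le hr with heq | hlt
  · rw [hW.leader_unique hl.mem hl' hl.isLeader hL' heq]
    exact ⟨[], by simp, by simp⟩
  · have h1 := hl.isLeader.odd
    have h2 := hL'.odd
    obtain ⟨rest, h, hrest⟩ := hl.chainBelow_eq hn hW (r := l'.round - 2) hl' (by omega)
      (by omega) (by omega)
    refine ⟨rest ++ [l'], ?_, ?_⟩
    · rw [chain, h, List.append_assoc]
    · intro u hu
      rcases List.mem_append.1 hu with hu | hu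
      · exact hrest u hu
      · rwa [List.mem_singleton.1 hu]

/-- The loop of a party with a sound DAG computes the chain. -/
theorem leaderLoop_eq (hW : Coherent f W) {dag : Finset (Vertex n B)} (hs : Sound f dag)
    (hdag : ∀ v ∈ dag, v ∈ W) (c r : ℕ) (v : Vertex n B) (stack : List (Vertex n B))
    (hv : v ∈ dag) (hvr : 1 ≤ v.round) (hodd : r = 0 ∨ r % 2 = 1) (hle : r ≤ v.round) :
    (leaderLoop P dag c r v stack).2 = chainBelow P W c r v ++ stack ∧
      (leaderLoop P dag c r v stack).1.round ≤ v.round := by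
  induction r using Nat.strong_induction_on generalizing v stack with
  | _ r ih =>
    by_cases hc : c < r
    · have hodd' : r % 2 = 1 := by omega
      have hloop : leaderLoop P dag c r v stack =
          match leaderIn P dag r with
          | some u =>
            if StrongPath dag v u then leaderLoop P dag c (r - 2) u (u :: stack)
            else leaderLoop P dag c (r - 2) v stack
          | none => leaderLoop P dag c (r - 2) v stack := by
        rw [leaderLoop, dif_pos hc]
        rfl
      rw [hloop]
      have hskip := ih (r - 2) (by omega) v stack hv hvr (by omega) (by omega)
      cases hlead : leaderIn P dag r with
      | none =>
        rw [chainBelow_of_not hc]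
        · exact hskip
        · intro u hu hvu
          obtain ⟨-, hL, rfl⟩ := globalLeader_spec hu
          -- A strongly reached leader of `W` lies in the local DAG, so the local lookup cannot have
          -- failed.
          exact leaderIn_ne_none (hs.strongPath_of_stronglyReaches hv hvr hvu).2.1 hL hlead
      | some u =>
        obtain ⟨hu, hur, hL⟩ := leaderIn_spec hodd' hlead
        -- By uniqueness in `W`, the local leader vertex is the global one.
        have hgl := hW.globalLeader_eq (hdag u hu) hL
        rw [hur] at hgl
        dsimp only
        split_ifs with hp
        · rw [chainBelow_of_some hc hgl hp.stronglyReaches]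
          obtain ⟨h₁, h₂⟩ := ih (r - 2) (by omega) u (u :: stack) hu (by omega) (by omega)
            (by omega)
          refine ⟨?_, by omega⟩
          rw [h₁, List.append_assoc, List.singleton_append]
        · rw [chainBelow_of_not hc]
          · exact hskip
          · intro u' hu' hvu'
            rw [hgl] at hu'
            obtain rfl := Option.some.inj hu'
            exact hp (hs.strongPath_of_stronglyReaches hv hvr hvu').1
    · rw [leaderLoop, dif_neg hc, chainBelow_of_le (by omega)]
      exact ⟨rfl, le_rfl⟩

/-! ### Delivery of the causal histories of a list of leaders -/

/-- The vertices of rounds `≥ 1` that can be reached from `v`. -/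
def history (v : Vertex n B) : Finset (Vertex n B) :=
  -- The default `∅` is never used for a vertex of round at least 1 in a sound DAG: its history lies
  -- in that DAG and is finite.
  if h : {u : Vertex n B | 1 ≤ u.round ∧ Reaches v u}.Finite then h.toFinset else ∅

theorem mem_history {v u : Vertex n B} (h : u ∈ history v) : 1 ≤ u.round ∧ Reaches v u := by
  unfold history at h
  split_ifs at h with hf
  · exact hf.mem_toFinset.1 h
  · exact absurd h (Finset.notMem_empty _)

theorem Sound.mem_history_iff {dag : Finset (Vertex n B)} (hs : Sound f dag) {v : Vertex n B}
    (hv : v ∈ dag) (hr : 1 ≤ v.round) (u : Vertex n B) :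
    u ∈ history v ↔ u ∈ dag ∧ 1 ≤ u.round ∧ Path dag v u := by
  have hfin : {u : Vertex n B | 1 ≤ u.round ∧ Reaches v u}.Finite :=
    dag.finite_toSet.subset fun u hu => (hs.path_of_reaches hv hr hu.2).2.1
  constructor
  · intro h
    obtain ⟨h1, h⟩ := mem_history h
    obtain ⟨hp, hu, -⟩ := hs.path_of_reaches hv hr h
    exact ⟨hu, h1, hp⟩
  · rintro ⟨-, h1, hp⟩
    unfold history
    rw [dif_pos hfin]
    exact hfin.mem_toFinset.2 ⟨h1, Relation.ReflTransGen.mono (fun _ _ h => h.2) _ _ hp⟩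

/-- The effect of popping a leader on the delivered vertices and the output. -/
def deliverHistory (P : Params f n B) (x : Finset (Vertex n B) × List (B × ℕ × Fin n))
    (v : Vertex n B) : Finset (Vertex n B) × List (B × ℕ × Fin n) :=
  (x.1 ∪ history v,
    x.2 ++ (P.order (history v \ x.1)).map fun u => (u.block, u.round, u.source))

/-- The delivered vertices and the output. -/
def LocalState.deliveries (s : LocalState n B) :
    Finset (Vertex n B) × List (B × ℕ × Fin n) :=
  (s.deliveredVertices, s.output)

/-- The local DAG drops out: being closed under edges, it contains the entire history of `v`. -/
theorem orderLeader_deliveries {s : LocalState n B} (hs : Sound f s.dag) {v : Vertex n B}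
    (hv : v ∈ s.dag) (hr : 1 ≤ v.round) :
    (orderLeader P s v).deliveries = deliverHistory P s.deliveries v := by
  have h : (s.dag.filter fun u => 1 ≤ u.round ∧ Path s.dag v u ∧ u ∉ s.deliveredVertices) =
      history v \ s.deliveredVertices := by
    ext u
    rw [Finset.mem_filter, Finset.mem_sdiff, hs.mem_history_iff hv hr]
    tauto
  unfold orderLeader deliverHistory LocalState.deliveries
  dsimp only
  rw [h, Finset.union_sdiff_self_eq_union]

theorem orderVertices_deliveries {stack : List (Vertex n B)} {s : LocalState n B}
    (hs : Sound f s.dag) (hstack : ∀ v ∈ stack, v ∈ s.dag ∧ 1 ≤ v.round) :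
    (orderVertices P s stack).deliveries = stack.foldl (deliverHistory P) s.deliveries := by
  induction stack generalizing s with
  | nil => rfl
  | cons v l ih =>
    obtain ⟨hv, hr⟩ := hstack v List.mem_cons_self
    have := ih (s := orderLeader P s v) hs fun u hu => hstack u (List.mem_cons_of_mem _ hu)
    rw [orderLeader_deliveries hs hv hr] at this
    exact this

theorem deliverHistory_of_subset {x : Finset (Vertex n B) × List (B × ℕ × Fin n)}
    {v : Vertex n B} (h : history v ⊆ x.1) : deliverHistory P x v = x := by
  have hnil : P.order ∅ = [] :=
    List.eq_nil_iff_forall_not_mem.2 fun u hu => Finset.notMem_empty u ((P.mem_order ∅ u).1 hu)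
  unfold deliverHistory
  rw [Finset.sdiff_eq_empty_iff_subset.2 h, hnil, Finset.union_eq_left.2 h]
  simp

/-- This is what makes it harmless to pop a leader a second time. -/
theorem foldl_deliverHistory_of_subset {l : List (Vertex n B)}
    {x : Finset (Vertex n B) × List (B × ℕ × Fin n)} (h : ∀ v ∈ l, history v ⊆ x.1) :
    l.foldl (deliverHistory P) x = x := by
  induction l with
  | nil => rfl
  | cons v l ih =>
    rw [List.foldl_cons, deliverHistory_of_subset (h v List.mem_cons_self)]
    exact ih fun u hu => h u (List.mem_cons_of_mem _ hu)

theorem mem_foldl_deliverHistory {l : List (Vertex n B)}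
    {x : Finset (Vertex n B) × List (B × ℕ × Fin n)} {u : Vertex n B} :
    u ∈ (l.foldl (deliverHistory P) x).1 ↔ u ∈ x.1 ∨ ∃ v ∈ l, u ∈ history v := by
  induction l generalizing x with
  | nil => simp
  | cons v l ih =>
    rw [List.foldl_cons, ih]
    simp only [deliverHistory, Finset.mem_union, List.mem_cons, exists_eq_or_imp, or_assoc]

theorem prefix_foldl_deliverHistory (l : List (Vertex n B))
    (x : Finset (Vertex n B) × List (B × ℕ × Fin n)) :
    x.2 <+: (l.foldl (deliverHistory P) x).2 := by
  induction l generalizing x with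
  | nil => exact List.prefix_rfl
  | cons v l ih => exact (List.prefix_append _ _).trans (ih (deliverHistory P x v))

/-- The delivered vertices and the output after the first delivery of a list of leaders. -/
def deliverAll (P : Params f n B) (l : List (Vertex n B)) :
    Finset (Vertex n B) × List (B × ℕ × Fin n) :=
  l.foldl (deliverHistory P) (∅, [])

theorem history_subset_deliverAll {l : List (Vertex n B)} {v : Vertex n B} (h : v ∈ l) :
    history v ⊆ (deliverAll P l).1 := fun _ hu =>
  mem_foldl_deliverHistory.2 (Or.inr ⟨v, h, hu⟩)

theorem foldl_deliverAll_self_append (l rest : List (Vertex n B)) :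
    (l ++ rest).foldl (deliverHistory P) (deliverAll P l) = deliverAll P (l ++ rest) := by
  rw [List.foldl_append, foldl_deliverHistory_of_subset fun v hv => history_subset_deliverAll hv,
    deliverAll, deliverAll, List.foldl_append]

/-- An output shows only block, round and source, but in `W` round and source determine the vertex;
thus new vertices produce new outputs. -/
theorem Coherent.deliverAll_nodup (hW : Coherent f W) {l : List (Vertex n B)}
    (hl : ∀ v ∈ l, v ∈ W ∧ 1 ≤ v.round) : (deliverAll P l).2.Nodup := by
  have hist : ∀ v ∈ l, ∀ u ∈ history v, u ∈ W ∧ 1 ≤ u.round := fun v hv u hu =>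
    hW.mem_of_reaches (hl v hv).1 (hl v hv).2 (mem_history hu).2
  -- Generalized over the accumulator, with the invariant that each output so far comes from a
  -- delivered vertex of `W`.
  have key : ∀ (l : List (Vertex n B)) (x : Finset (Vertex n B) × List (B × ℕ × Fin n)),
      (∀ v ∈ l, ∀ u ∈ history v, u ∈ W ∧ 1 ≤ u.round) → (∀ u ∈ x.1, u ∈ W ∧ 1 ≤ u.round) →
      (∀ y ∈ x.2, ∃ u ∈ x.1, (u.block, u.round, u.source) = y) → x.2.Nodup →
      (l.foldl (deliverHistory P) x).2.Nodup := by
    intro l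
    induction l with
    | nil => intro x _ _ _ h; exact h
    | cons v l ih =>
      intro x hl hx ho hnd
      have hv := hl v List.mem_cons_self
      have hmem : ∀ u ∈ P.order (history v \ x.1), u ∈ history v ∧ u ∉ x.1 := fun u hu =>
        Finset.mem_sdiff.1 ((P.mem_order _ u).1 hu)
      have heq : ∀ a b : Vertex n B, a ∈ W ∧ 1 ≤ a.round → b ∈ W ∧ 1 ≤ b.round →
          (a.block, a.round, a.source) = (b.block, b.round, b.source) → a = b := by
        intro a b ha hb hab
        simp only [Prod.mk.injEq] at hab
        exact hW.unique a ha.1 b hb.1 ha.2 hab.2.1 hab.2.2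
      refine ih _ (fun u hu => hl u (List.mem_cons_of_mem _ hu)) ?_ ?_ ?_
      · intro u hu
        rcases Finset.mem_union.1 hu with hu | hu
        · exact hx u hu
        · exact hv u hu
      · intro y hy
        rcases List.mem_append.1 hy with hy | hy
        · obtain ⟨u, hu, h⟩ := ho y hy
          exact ⟨u, Finset.mem_union_left _ hu, h⟩
        · obtain ⟨u, hu, h⟩ := List.mem_map.1 hy
          exact ⟨u, Finset.mem_union_right _ (hmem u hu).1, h⟩
      · refine List.Nodup.append hnd ?_ ?_
        · exact List.Nodup.map_on (fun a ha b hb hab =>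
            heq a b (hv a (hmem a ha).1) (hv b (hmem b hb).1) hab) (P.order_nodup _)
        · intro y hy hy'
          obtain ⟨u, hu, rfl⟩ := ho y hy
          obtain ⟨u', hu', h⟩ := List.mem_map.1 hy'
          rw [heq u' u (hv u' (hmem u' hu').1) (hx u hu) h] at hu'
          exact (hmem u hu').2 hu
  exact key l _ hist (by simp) (by simp) (by simp)

/-! ### The output of a party -/

/-- The output is that of the full chain of some certified leader, and the counter `committedRound`
does not exceed the round of this leader. -/
def Ordered (P : Params f n B) (W : Set (Vertex n B)) (s : LocalState n B) : Prop :=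
  (s.committedRound = 0 ∧ s.deliveries = (∅, [])) ∨
    ∃ l, Certified P W l ∧ s.committedRound ≤ l.round ∧
      s.deliveries = deliverAll P (chain P W 0 l)

/-- The counter receives the round of the oldest leader pushed, not of `l`; hence only an
inequality. -/
theorem commitLeader_spec (hW : Coherent f W) {s : LocalState n B} (hs : Sound f s.dag)
    (hdag : ∀ v ∈ s.dag, v ∈ W) {l : Vertex n B} (hl : l ∈ s.dag) (hL : IsLeader P l) :
    (commitLeader P s l).committedRound ≤ l.round ∧
      (commitLeader P s l).deliveries =
        (chain P W s.committedRound l).foldl (deliverHistory P) s.deliveries := by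
  have hodd := hL.odd
  obtain ⟨h₁, h₂⟩ := leaderLoop_eq (P := P) hW hs hdag s.committedRound (l.round - 2) l [l] hl
    (by omega) (by omega) (by omega)
  unfold commitLeader
  dsimp only
  refine ⟨?_, ?_⟩
  · rw [(orderVertices_frame P _ _).2.2.2]
    exact h₂
  · rw [h₁]
    refine orderVertices_deliveries hs ?_
    intro v hv
    rcases List.mem_append.1 hv with hv | hv
    · exact ⟨mem_dag_of_mem_chainBelow hs hl (by omega) hv, (mem_chainBelow hv).2.1⟩
    · rw [List.mem_singleton.1 hv]
      exact ⟨hl, by omega⟩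

/-- If `l` is at least as high as the last maximal leader `l₀`, the part of its chain cut off by
`committedRound` was delivered with `l₀`, so the truncated chain has the effect of the full one. If
`l` is at most as high, its chain is part of what was delivered and nothing changes. -/
theorem Ordered.commitLeader (hn : n = 3 * f + 1) (hW : Coherent f W) {s : LocalState n B}
    (hs : Sound f s.dag) (hdag : ∀ v ∈ s.dag, v ∈ W) {l : Vertex n B} (hl : l ∈ s.dag)
    (hcert : Certified P W l) (h : Ordered P W s) : Ordered P W (commitLeader P s l) := by
  obtain ⟨hc, hd⟩ := commitLeader_spec hW hs hdag hl hcert.isLeader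
  rcases h with ⟨h0, h⟩ | ⟨l₀, hl₀, hle, h⟩
  · refine Or.inr ⟨l, hcert, hc, ?_⟩
    rw [hd, h0, h, deliverAll]
  · obtain ⟨pre, hpre, hprec⟩ := chain_eq_append (P := P) (W := W) s.committedRound l
    rcases le_total l₀.round l.round with hr | hr
    · refine Or.inr ⟨l, hcert, hc, ?_⟩
      obtain ⟨rest, hrest, hgt⟩ := hl₀.chain_eq hn hW hcert.mem hcert.isLeader hr
      rw [hd, h, hrest, ← foldl_deliverAll_self_append, ← hrest, hpre, List.foldl_append]
      congr 1
      refine (foldl_deliverHistory_of_subset fun v hv => history_subset_deliverAll ?_).symm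
      have hv' : v ∈ chain P W 0 l₀ ++ rest := by
        rw [← hrest, hpre]
        exact List.mem_append_left _ hv
      rcases List.mem_append.1 hv' with hv' | hv'
      · exact hv'
      -- A leader cut off has round at most `committedRound ≤ l₀.round`, whereas those in `rest` are
      -- above `l₀.round`.
      · have := hprec v hv
        have := hgt v hv'
        omega
    · refine Or.inr ⟨l₀, hl₀, hc.trans hr, ?_⟩
      obtain ⟨rest, hrest, -⟩ := hcert.chain_eq hn hW hl₀.mem hl₀.isLeader hr
      rw [hd, h]
      refine foldl_deliverHistory_of_subset fun v hv => history_subset_deliverAll ?_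
      rw [hrest, hpre]
      exact List.mem_append_left _ (List.mem_append_right _ hv)

theorem Ordered.microStep (hn : n = 3 * f + 1) (hW : Coherent f W) {s s' : LocalState n B}
    (hs : Sound f s.dag) (hdag : ∀ v ∈ s.dag, v ∈ W) (h : Ordered P W s)
    (hstep : MicroStep P s s') : Ordered P W s' := by
  have frame : s'.committedRound = s.committedRound →
      s'.deliveredVertices = s.deliveredVertices → s'.output = s.output → Ordered P W s' := by
    intro hc hd ho
    unfold Ordered LocalState.deliveries
    rw [hc, hd, ho]
    exact h
  cases hstep with
  | addVertex v hr hp _ hc hd ho => exact frame hc hd ho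
  | idle _ hc hd ho => exact frame hc hd ho
  | commit v l hv hl hL hr hc =>
    refine h.commitLeader hn hW hs hdag hl ⟨hdag l hl, hL, v, hdag v hv, hr, hc.trans ?_⟩
    refine Finset.card_le_card fun u hu => ?_
    obtain ⟨hu, hp⟩ := Finset.mem_filter.1 hu
    exact Finset.mem_filter.2 ⟨hu, hp.stronglyReaches⟩

theorem Ordered.steps (hn : n = 3 * f + 1) (hW : Coherent f W) {s s' : LocalState n B}
    (hs : Sound f s.dag) (h : Ordered P W s)
    (hsteps : Relation.ReflTransGen (MicroStep P) s s') (hdag : ∀ v ∈ s'.dag, v ∈ W) :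
    Ordered P W s' := by
  induction hsteps with
  | refl => exact h
  | tail hst hstep ih =>
    have hdag' := fun v hv => hdag v (hstep.dag_subset hv)
    exact (ih hdag').microStep hn hW (sound_of_steps hst hs) hdag' hstep

theorem Ordered.prefix_or_prefix (hn : n = 3 * f + 1) (hW : Coherent f W)
    {s s' : LocalState n B} (h : Ordered P W s) (h' : Ordered P W s') :
    s.output <+: s'.output ∨ s'.output <+: s.output := by
  rcases h with ⟨-, h⟩ | ⟨l, hl, -, h⟩
  · rw [show s.output = [] from congrArg Prod.snd h]
    exact Or.inl List.nil_prefix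
  rcases h' with ⟨-, h'⟩ | ⟨l', hl', -, h'⟩
  · rw [show s'.output = [] from congrArg Prod.snd h']
    exact Or.inr List.nil_prefix
  rw [show s.output = _ from congrArg Prod.snd h, show s'.output = _ from congrArg Prod.snd h']
  rcases le_total l.round l'.round with hr | hr
  · obtain ⟨rest, hrest, -⟩ := hl.chain_eq hn hW hl'.mem hl'.isLeader hr
    rw [hrest, ← foldl_deliverAll_self_append, List.foldl_append, foldl_deliverHistory_of_subset
      fun v hv => history_subset_deliverAll hv]
    exact Or.inl (prefix_foldl_deliverHistory _ _)
  · obtain ⟨rest, hrest, -⟩ := hl'.chain_eq hn hW hl.mem hl.isLeader hr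
    rw [hrest, ← foldl_deliverAll_self_append, List.foldl_append, foldl_deliverHistory_of_subset
      fun v hv => history_subset_deliverAll hv]
    exact Or.inr (prefix_foldl_deliverHistory _ _)

theorem Ordered.output_nodup (hW : Coherent f W) {s : LocalState n B} (h : Ordered P W s) :
    s.output.Nodup := by
  rcases h with ⟨-, h⟩ | ⟨l, hl, -, h⟩
  · rw [show s.output = [] from congrArg Prod.snd h]
    exact List.nodup_nil
  · rw [show s.output = _ from congrArg Prod.snd h]
    exact hW.deliverAll_nodup fun v hv => mem_chain hl.mem hl.one_le_round hv

/-! ### Executions -/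

variable {honest : Finset (Fin n)}

namespace Execution

/-- The proper vertices delivered to party `i` by reliable broadcast. -/
def delivered (E : Execution P honest) (i : Fin n) : Set (Vertex n B) :=
  {v | Proper f v ∧ ∃ t, E.DeliversAt t i v v.round v.source}

/-- The vertices in the local DAGs of honest parties. -/
def vertices (E : Execution P honest) : Set (Vertex n B) :=
  {v | ∃ i ∈ honest, ∃ t, v ∈ (E.state t i).dag}

variable (E : Execution P honest)

theorem evolves (hi : i ∈ honest) (t : ℕ) (hg : P.genesis ⊆ (E.state t i).dag)
    (hb : ∀ v ∈ (E.state t i).buffer, v ∈ E.delivered i) :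
    Evolves P i (E.delivered i) (E.state t i) (E.state (t + 1) i) := by
  by_cases he : ∃ e, E.event t = some (i, e)
  · obtain ⟨e, he⟩ := he
    refine Evolves.localStep hg hb (fun _ hu => hu.1) ?_ (E.step t i hi e he)
    rintro v r p rfl hL
    refine ⟨hL.proper, t, ?_⟩
    obtain ⟨rfl, rfl, -⟩ := hL
    exact he
  · rw [E.idle t i hi fun e h => he ⟨e, h⟩]
    exact .refl _

/-- The invariants of the local states that do not concern the order. -/
theorem invariants (hi : i ∈ honest) (t : ℕ) :
    P.genesis ⊆ (E.state t i).dag ∧ (∀ v ∈ (E.state t i).buffer, v ∈ E.delivered i) ∧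
      Sound f (E.state t i).dag ∧
      ∀ v ∈ (E.state t i).dag, 1 ≤ v.round →
        v ∈ E.delivered i ∨ (v.source = i ∧ ∃ t, (v, v.round) ∈ (E.state t i).sent) := by
  induction t with
  | zero =>
    rw [E.state_zero i hi]
    refine ⟨Finset.Subset.refl _, by simp [initialState], ?_, ?_⟩
    · intro v hv h1
      have := P.genesis_round v hv
      omega
    · intro v hv h1
      have := P.genesis_round v hv
      omega
  | succ t ih =>
    obtain ⟨hg, hb, hs, ho⟩ := ih
    have e := E.evolves hi t hg hb
    refine ⟨hg.trans (dag_subset_of_steps e.steps), fun v hv => ?_, sound_of_steps e.steps hs,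
      fun v hv h1 => ?_⟩
    · rcases e.buffer v hv with hv | hv
      · exact hb v hv
      · exact hv
    · rcases e.origin v hv with hv | hv | hv
      · exact ho v hv h1
      · exact Or.inl hv
      · exact Or.inr ⟨hv.1, t + 1, hv.2⟩

theorem steps (hi : i ∈ honest) (t : ℕ) :
    Relation.ReflTransGen (MicroStep P) (E.state t i) (E.state (t + 1) i) :=
  (E.evolves hi t (E.invariants hi t).1 (E.invariants hi t).2.1).steps

variable {E}

/-- Agreement handles vertices received from the broadcast; validity handles a party's own vertices,
which enter its DAG before any delivery. -/
theorem ReliableBroadcast.exists_deliversAt (hE : E.ReliableBroadcast) (hi : i ∈ honest)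
    {v : Vertex n B} (hv : v ∈ E.vertices) (h1 : 1 ≤ v.round) :
    ∃ t, E.DeliversAt t i v v.round v.source := by
  obtain ⟨j, hj, t, hv⟩ := hv
  rcases (E.invariants hj t).2.2.2 v hv h1 with ⟨-, t', h⟩ | ⟨hs, t', h⟩
  · exact hE.agreement j hj i hi t' v _ _ h
  · rw [hs]
    exact hE.validity j hj t' v _ h i hi

theorem ReliableBroadcast.coherent (hE : E.ReliableBroadcast) : Coherent f E.vertices where
  proper := by
    rintro v ⟨i, hi, t, hv⟩ h1
    exact ((E.invariants hi t).2.2.1 v hv h1).1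
  edges := by
    rintro v ⟨i, hi, t, hv⟩ h1 u hu
    exact ⟨i, hi, t, ((E.invariants hi t).2.2.1 v hv h1).2 u hu⟩
  unique := by
    intro u hu v hv h1 hr hs
    obtain ⟨i, hi, -⟩ := id hu
    obtain ⟨t, ht⟩ := hE.exists_deliversAt hi hu h1
    obtain ⟨t', ht'⟩ := hE.exists_deliversAt hi hv (hr ▸ h1)
    rw [← hr, ← hs] at ht'
    -- Integrity equates the times; since each time carries at most one event, the vertices agree as
    -- well.
    obtain rfl := hE.integrity i hi _ _ t t' u v ht ht'
    have h := ht.symm.trans ht'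
    simp only [Option.some.injEq, Prod.mk.injEq, LocalEvent.rDeliver.injEq, true_and,
      and_true] at h
    exact h

theorem ReliableBroadcast.ordered (hn : n = 3 * f + 1) (hE : E.ReliableBroadcast)
    (hi : i ∈ honest) (t : ℕ) : Ordered P E.vertices (E.state t i) := by
  induction t with
  | zero =>
    rw [E.state_zero i hi]
    exact Or.inl ⟨rfl, rfl⟩
  | succ t ih =>
    exact ih.steps hn hE.coherent (E.invariants hi t).2.2.1 (E.steps hi t)
      fun v hv => ⟨i, hi, t + 1, hv⟩

theorem ReliableBroadcast.totalOrder (hn : n = 3 * f + 1) (hE : E.ReliableBroadcast) :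
    E.TotalOrder := by
  rintro i hi j hj x y ⟨t, k, l, hkl, hk, hl⟩ ⟨t', k', l', hkl', hk', hl'⟩
  have ho := hE.ordered hn hi t
  have ho' := hE.ordered hn hj t'
  -- Here `o` is the longer of the two outputs. Positions in it are determined by the entries, so `k
  -- = l'` and `l = k'`, against `k < l` and `k' < l'`.
  have key : ∀ {o : List (B × ℕ × Fin n)}, o.Nodup → (E.state t i).output <+: o →
      (E.state t' j).output <+: o → False := by
    intro o hnd h h'
    have lift : ∀ {o' : List (B × ℕ × Fin n)} {m : ℕ} {z : B × ℕ × Fin n}, o' <+: o →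
        o'[m]? = some z → o[m]? = some z ∧ m < o.length := by
      intro o' m z hp hm
      obtain ⟨hlt, -⟩ := List.getElem?_eq_some_iff.1 hm
      obtain ⟨tl, rfl⟩ := hp
      refine ⟨by rw [List.getElem?_append_left hlt, hm], ?_⟩
      rw [List.length_append]
      omega
    have hx := (lift h hk).1.trans (lift h' hl').1.symm
    have hy := (lift h hl).1.trans (lift h' hk').1.symm
    have h₁ := (List.getElem?_inj (lift h hk).2 hnd).1 hx
    have h₂ := (List.getElem?_inj (lift h hl).2 hnd).1 hy
    omega
  rcases ho.prefix_or_prefix hn hE.coherent ho' with h | h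
  · exact key (ho'.output_nodup hE.coherent) h List.prefix_rfl
  · exact key (ho.output_nodup hE.coherent) List.prefix_rfl h

end Execution

end

end BullShark

theorem mainTheorem5 {B : Type*} (f n : ℕ) (hn : n = 3 * f + 1)
    (P : BullShark.Params f n B) (honest : Finset (Fin n)) (hf : honestᶜ.card ≤ f)
    (E : BullShark.Execution P honest) (hE : E.ReliableBroadcast) :
    E.TotalOrder :=
  hE.totalOrder hn
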